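/- Let $AP$ be a finite set of atomic propositions. A (finitely variable) signal is a map $f:\mathbb R_{\ge 0}\to 2^{AP}$ with only finitely many discontinuities in every bounded interval. Intervals have the form $\langle a,b\rangle$ with $a\in\mathbb N$, $b\in\mathbb N\cup\{\infty\}$, each end open or closed, and are called non-singular if $a<b$. Consider formulae built from $\top$ and the propositions $P\in AP$ by $\wedge$, $\neg$, the until modalities $\varphi_1\,\mathbf U_I\,\varphi_2$ and the counting modalities $\mathbf C^k_I\varphi$ ($k\ge 1$), where all intervals $I$ are non-singular. In the continuous semantics these are interpreted at times $t\in\mathbb R_{\ge0}$ of a signal $f$: $P$ holds at $t$ iff $P\in f(t)$; $\top$, $\wedge$, $\neg$ are as usual; $\varphi_1\,\mathbf U_I\,\varphi_2$ holds at $t$ iff there is $u>t$ with $u-t\in I$ such that $\varphi_2$ holds at $u$ and $\varphi_1$ holds at all $s$ with $t<s<u$; and $\mathbf C^k_I\varphi$ holds at $t$ iff there are times $t<t_1<\dots<t_k$ with $t_i-t\in I$ such that $\varphi$ holds at every $t_i$. Let $\mathsf{TLCI}^{\mathsf{fut}}$ be the set of all these formulae, and let $\mathsf{TLC}^{\mathsf{fut}}$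 be the set of those in which every counting modality $\mathbf C^k_I$ has an interval of the form $I=[0,b\rangle$ with $b\in\mathbb N_{>0}\cup\{\infty\}$ (the intervals of the until modalities remain arbitrary non-singular ones). Then $\mathsf{TLCI}^{\mathsf{fut}}\subseteq\mathsf{TLC}^{\mathsf{fut}}$ in the continuous semantics, that is, for every $\varphi\in\mathsf{TLCI}^{\mathsf{fut}}$ there is $\varphi'\in\mathsf{TLC}^{\mathsf{fut}}$ such that $\varphi$ and $\varphi'$ have the same truth value at time $0$ of every signal. Moreover, $\mathsf{TLC}^{\mathsf{fut}}$ is expressively complete for $\mathsf{TLCI}^{\mathsf{fut}}$: for every $\varphi\in\mathsf{TLCI}^{\mathsf{fut}}$ there is $\varphi'\in\mathsf{TLC}^{\mathsf{fut}}$ such that $\varphi$ and $\varphi'$ have the same truth value at every time $t\ge 0$ of every signal. -/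

import Mathlib

open scoped NNReal Topology

namespace TimedLogic

/-- Finitely variable signals over the atomic propositions `AP`: maps from `ℝ≥0` to `2^AP` with
only finitely many discontinuities in every bounded interval (`2^AP` being discrete, a
discontinuity is a time near which the map is not constant). The value at a discontinuity is
arbitrary, so propositions may hold at isolated times. -/
structure Signal (AP : Type*) where
  val : ℝ≥0 → Set AP
  finitelyVariable : ∀ T : ℝ≥0, {t : ℝ≥0 | t ≤ T ∧ ¬ ∀ᶠ s in 𝓝 t, val s = val t}.Finite

/-- Intervals `⟨lower, upper⟩` of the real line with `lower ∈ ℕ`, `upper ∈ ℕ ∪ {∞}`, each end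
being closed or open. -/
structure Interval where
  lower : ℕ
  upper : ℕ∞
  leftClosed : Prop
  rightClosed : Prop

namespace Interval

/-- The set of reals denoted by an interval. (At an infinite upper end, the flag `rightClosed`
plays no role.) -/
def toSet (I : Interval) : Set ℝ :=
  {x | ((I.lower : ℝ) < x ∨ (I.leftClosed ∧ x = I.lower)) ∧
    ∀ b : ℕ, I.upper = b → x < b ∨ (I.rightClosed ∧ x = b)}

/-- Non-singular intervals `⟨a, b⟩`, `a < b`. -/
def nonSingular : Set Interval := {I | (I.lower : ℕ∞) < I.upper}

/-- Non-singular intervals of the form `[0, b⟩`. -/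
def zeroBased : Set Interval := {I | I ∈ nonSingular ∧ I.lower = 0 ∧ I.leftClosed}

end Interval

/-- Future formulae built from atomic propositions with Boolean connectives, the timed until
modalities and the counting modalities `C_I^k`, `k ≥ 1`. -/
inductive Formula (AP : Type*) where
  | top : Formula AP
  | atom (p : AP) : Formula AP
  | and (φ ψ : Formula AP) : Formula AP
  | neg (φ : Formula AP) : Formula AP
  | untl (I : Interval) (φ ψ : Formula AP) : Formula AP
  | count (k : ℕ+) (I : Interval) (φ : Formula AP) : Formula AP

/-- Continuous semantics: `Sat f φ t` means that `φ` holds in the signal `f` at time `t`.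
The until modality is strict in the future, and `C_I^k φ` says that `φ` holds at `k` distinct
times strictly after `t` whose distances from `t` are in `I`. -/
def Sat {AP : Type*} (f : Signal AP) : Formula AP → ℝ≥0 → Prop
  | .top, _ => True
  | .atom p, t => p ∈ f.val t
  | .and φ ψ, t => Sat f φ t ∧ Sat f ψ t
  | .neg φ, t => ¬ Sat f φ t
  | .untl I φ ψ, t => ∃ u : ℝ≥0, t < u ∧ (u : ℝ) - t ∈ I.toSet ∧ Sat f ψ u ∧
      ∀ s : ℝ≥0, t < s → s < u → Sat f φ s
  | .count k I φ, t => ∃ x : Fin k → ℝ≥0, StrictMono x ∧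
      ∀ i, t < x i ∧ ((x i : ℝ) - t) ∈ I.toSet ∧ Sat f φ (x i)

/-- All until modalities of the formula carry intervals from `U`, and all its counting
modalities carry intervals from `C`. -/
def Formula.Uses {AP : Type*} (U C : Set Interval) : Formula AP → Prop
  | .top => True
  | .atom _ => True
  | .and φ ψ => φ.Uses U C ∧ ψ.Uses U C
  | .neg φ => φ.Uses U C
  | .untl I φ ψ => I ∈ U ∧ φ.Uses U C ∧ ψ.Uses U C
  | .count _ I φ => I ∈ C ∧ φ.Uses U C

/-- `TLCI^fut`: `MITL^fut` (until with non-singular intervals) with the counting modalities over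
arbitrary non-singular intervals. -/
def TLCIfut (AP : Type*) : Set (Formula AP) :=
  {φ | φ.Uses Interval.nonSingular Interval.nonSingular}

/-- `TLC^fut`: `MITL^fut` with the counting modalities over non-singular intervals `[0, b⟩`. -/
def TLCfut (AP : Type*) : Set (Formula AP) :=
  {φ | φ.Uses Interval.nonSingular Interval.zeroBased}

/-- Two formulae are equivalent if they hold at the same times of all signals. -/
def Equivalent {AP : Type*} (φ ψ : Formula AP) : Prop :=
  ∀ (f : Signal AP) (t : ℝ≥0), Sat f φ t ↔ Sat f ψ t

/-- Two formulae are initially equivalent if they agree at time `0` of all signals. -/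
def InitiallyEquivalent {AP : Type*} (φ ψ : Formula AP) : Prop :=
  ∀ f : Signal AP, Sat f φ 0 ↔ Sat f ψ 0

/-- `L ⊆ L'` as logics: `L'` is at least as expressive as `L`. -/
def AtMostAsExpressive {AP : Type*} (L L' : Set (Formula AP)) : Prop :=
  ∀ φ ∈ L, ∃ ψ ∈ L', InitiallyEquivalent φ ψ

/-- `L'` is expressively complete for `L`. -/
def ExpressivelyComplete {AP : Type*} (L' L : Set (Formula AP)) : Prop :=
  ∀ φ ∈ L, ∃ ψ ∈ L', Equivalent φ ψ

end TimedLogic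

/-!
Formulae are replaced by their truth sets, which are sets of reals, and a family of sets indexed by
signals is called `Expressible` if a formula of `TLCfut` defines it. It has to be shown that
`countSet k I S` is expressible if `S` is (`Expressible.count_nonSingular`).

Over an unbounded interval, one until modality finds a first point in the interval, and the
remaining points are counted from there. A bounded interval at positive distance is a union of unit
intervals, so that the problem is to count the points of `S` in `t + ⟨a, a + 1⟩` with `a ≥ 1`. No
modality can refer to the time `t + a` directly.

Truth sets are regulated, that is, they have limits from both sides everywhere
(`regulated_truthSet`). Hence `S` consists of its right interior and of a discrete set `Q`. If the
right interior meets the open unit window, then the window contains infinitely many points, and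
otherwise only `Q` and the right end of the window have to be considered
(`le_encard_window_iff_sdiff_rightInterior`).

For discrete `Q`, let `D` be the set of those `s` for which at least `k` points of `Q` lie in
`s + ⟨0, 1⟩`. The left and the right limits of `D` at `s` are obtained by counting in
`[s, s + 1)` and in `(s, s + 1]`. So they are expressible without reference to the past, and with
them the jumps of `D`. Whether `t + a` is in `D` is determined by the right limit at `t` and
the parity of the number of jumps between `t` and `t + a` (`mem_iff_odd_jumps`). A jump occurs only
where a point of `Q` enters or leaves the window while fewer than `k` points are inside, so there are
at most `2k` of them per unit of time (`encard_criticalSites_inter_Ioc_le`). A bounded number can be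
determined by counting modalities over `[0, a⟩`, and so can its parity
(`Expressible.le_encard_shifted_unit_window`).
-/

open scoped NNReal Topology

namespace TimedLogic

open Set Filter

variable {AP : Type*}

/-! ### Expressible families of sets of times -/

theorem natCast_le_encard_iff_strictMono {α : Type*} [LinearOrder α] (k : ℕ) (A : Set α) :
    (k : ℕ∞) ≤ A.encard ↔ ∃ x : Fin k → α, StrictMono x ∧ ∀ i, x i ∈ A := by
  constructor
  · intro h
    obtain ⟨B, hBA, hB⟩ := Set.exists_subset_encard_eq h
    have hfin : B.Finite := Set.finite_of_encard_eq_coe hB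
    have hcard : hfin.toFinset.card = k := by
      have := hfin.encard_eq_coe_toFinset_card
      rw [hB] at this
      exact_mod_cast this.symm
    exact ⟨hfin.toFinset.orderEmbOfFin hcard, (hfin.toFinset.orderEmbOfFin hcard).strictMono,
      fun i => hBA (hfin.mem_toFinset.1 (Finset.orderEmbOfFin_mem _ hcard i))⟩
  · rintro ⟨x, hx, hA⟩
    have h1 : (Set.range x).encard = k := by
      rw [← Set.image_univ, hx.injective.encard_image, Set.encard_univ]
      simp
    rw [← h1]
    exact Set.encard_le_encard (Set.range_subset_iff.2 hA)

/-- The times at which the until modality over `I` holds, for arguments with truth sets `P`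
and `Q`. -/
def untilSet (I : Interval) (P Q : Set ℝ) : Set ℝ :=
  {t | ∃ u, t < u ∧ u - t ∈ I.toSet ∧ u ∈ Q ∧ Ioo t u ⊆ P}

/-- The times strictly after `t` whose distance from `t` is in `I`. -/
def Interval.after (I : Interval) (t : ℝ) : Set ℝ := {u | t < u ∧ u - t ∈ I.toSet}

/-- The times at which the counting modality over `I` holds, for an argument with truth
set `P`. -/
def countSet (k : ℕ) (I : Interval) (P : Set ℝ) : Set ℝ :=
  {t | (k : ℕ∞) ≤ (P ∩ I.after t).encard}

/-- `S` agrees with the truth set of `φ` in `f`; nothing is said about negative reals. -/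
def Represents (f : Signal AP) (φ : Formula AP) (S : Set ℝ) : Prop :=
  ∀ t : ℝ≥0, Sat f φ t ↔ (t : ℝ) ∈ S

theorem Represents.untl {f : Signal AP} {φ ψ : Formula AP} {P Q : Set ℝ}
    (hP : Represents f φ P) (hQ : Represents f ψ Q) (I : Interval) :
    Represents f (.untl I φ ψ) (untilSet I P Q) := by
  intro t
  constructor
  · rintro ⟨u, htu, hI, hu, h⟩
    refine ⟨u, htu, hI, (hQ u).1 hu, fun s hs => ?_⟩
    lift s to ℝ≥0 using t.2.trans hs.1.le
    exact (hP s).1 (h s (by exact_mod_cast hs.1) (by exact_mod_cast hs.2))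
  · rintro ⟨u, htu, hI, hu, h⟩
    lift u to ℝ≥0 using t.2.trans htu.le
    exact ⟨u, by exact_mod_cast htu, hI, (hQ u).2 hu, fun s h1 h2 =>
      (hP s).2 (h ⟨by exact_mod_cast h1, by exact_mod_cast h2⟩)⟩

theorem Represents.count {f : Signal AP} {φ : Formula AP} {P : Set ℝ}
    (hP : Represents f φ P) (k : ℕ+) (I : Interval) :
    Represents f (.count k I φ) (countSet k I P) := by
  intro t
  have himg : P ∩ I.after t =
      (fun x : ℝ≥0 => (x : ℝ)) '' {x | t < x ∧ ((x : ℝ) - t) ∈ I.toSet ∧ Sat f φ x} := by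
    ext u
    constructor
    · rintro ⟨hu, htu, hI⟩
      lift u to ℝ≥0 using t.2.trans htu.le
      exact ⟨u, ⟨by exact_mod_cast htu, hI, (hP u).2 hu⟩, rfl⟩
    · rintro ⟨x, ⟨h1, h2, h3⟩, rfl⟩
      exact ⟨(hP x).1 h3, NNReal.coe_lt_coe.2 h1, h2⟩
  change _ ↔ ((k : ℕ) : ℕ∞) ≤ (P ∩ I.after t).encard
  rw [himg, NNReal.coe_injective.encard_image, natCast_le_encard_iff_strictMono]
  rfl

/-- A family of sets of times, indexed by signals, is expressible if some formula of
`TLCfut` defines it at all nonnegative times of all signals. -/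
def Expressible (S : Signal AP → Set ℝ) : Prop :=
  ∃ ψ ∈ TLCfut AP, ∀ f, Represents f ψ (S f)

namespace Expressible

variable {S T : Signal AP → Set ℝ}

theorem congr (hS : Expressible S)
    (h : ∀ f, ∀ t : ℝ, 0 ≤ t → (t ∈ S f ↔ t ∈ T f)) : Expressible T := by
  obtain ⟨ψ, hψ, hr⟩ := hS
  exact ⟨ψ, hψ, fun f t => (hr f t).trans (h f t t.2)⟩

theorem univ : Expressible fun _ : Signal AP => Set.univ :=
  ⟨.top, trivial, fun _ _ => Iff.rfl⟩

theorem compl (hS : Expressible S) : Expressible fun f => (S f)ᶜ := by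
  obtain ⟨φ, hφ, hS⟩ := hS
  exact ⟨.neg φ, hφ, fun f t => not_congr (hS f t)⟩

theorem inter (hS : Expressible S) (hT : Expressible T) : Expressible fun f => S f ∩ T f := by
  obtain ⟨φ, hφ, hS⟩ := hS
  obtain ⟨ψ, hψ, hT⟩ := hT
  exact ⟨.and φ ψ, ⟨hφ, hψ⟩, fun f t => and_congr (hS f t) (hT f t)⟩

theorem union (hS : Expressible S) (hT : Expressible T) : Expressible fun f => S f ∪ T f :=
  (hS.compl.inter hT.compl).compl.congr fun f t _ => by simp [← Set.compl_union]

theorem empty : Expressible fun _ : Signal AP => (∅ : Set ℝ) :=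
  univ.compl.congr fun f t _ => by simp

theorem const (p : Prop) : Expressible fun _ : Signal AP => {_t : ℝ | p} := by
  by_cases hp : p
  · exact univ.congr fun f t _ => by simp [hp]
  · exact empty.congr fun f t _ => by simp [hp]

theorem iff (hS : Expressible S) (hT : Expressible T) :
    Expressible fun f => {t | t ∈ S f ↔ t ∈ T f} :=
  ((hS.inter hT).union (hS.compl.inter hT.compl)).congr fun f t _ => by
    simp only [mem_union, mem_inter_iff, mem_compl_iff, mem_ofPred_eq]; tauto

theorem exists_lt {R : ℕ → Signal AP → Set ℝ} (n : ℕ) (h : ∀ i, Expressible (R i)) :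
    Expressible fun f => {t | ∃ i < n, t ∈ R i f} := by
  induction n with
  | zero => exact empty.congr fun f t _ => by simp
  | succ n ih =>
    refine (ih.union (h n)).congr fun f t _ => ?_
    simp only [mem_union, mem_ofPred_eq, Nat.lt_succ_iff_lt_or_eq]
    grind

theorem untl {I : Interval} (hI : I ∈ Interval.nonSingular) (hS : Expressible S)
    (hT : Expressible T) : Expressible fun f => untilSet I (S f) (T f) := by
  obtain ⟨φ, hφ, hS⟩ := hS
  obtain ⟨ψ, hψ, hT⟩ := hT
  exact ⟨.untl I φ ψ, ⟨hI, hφ, hψ⟩, fun f => (hS f).untl (hT f) I⟩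

theorem count {I : Interval} (hI : I ∈ Interval.zeroBased) (k : ℕ) (hS : Expressible S) :
    Expressible fun f => countSet k I (S f) := by
  obtain rfl | hk := Nat.eq_zero_or_pos k
  · exact univ.congr fun f t _ => by simp [countSet]
  · obtain ⟨φ, hφ, hS⟩ := hS
    exact ⟨.count ⟨k, hk⟩ I φ, ⟨hI, hφ⟩, fun f => (hS f).count ⟨k, hk⟩ I⟩

end Expressible

/-- The bounded interval of reals from `x` to `y` that contains `x` if `lc` holds and `y` if `rc`
holds. -/
def window (lc rc : Prop) (x y : ℝ) : Set ℝ :=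
  {u | (x < u ∨ (lc ∧ u = x)) ∧ (u < y ∨ (rc ∧ u = y))}

theorem Ioo_subset_window (lc rc : Prop) (x y : ℝ) : Ioo x y ⊆ window lc rc x y :=
  fun _ hu => ⟨.inl hu.1, .inl hu.2⟩

theorem window_subset_Icc (lc rc : Prop) (x y : ℝ) : window lc rc x y ⊆ Icc x y := by
  rintro u ⟨h1, h2⟩
  constructor
  · rcases h1 with h | h
    exacts [h.le, h.2.ge]
  · rcases h2 with h | h
    exacts [h.le, h.2.le]

/-- For a bounded interval, `Interval.after` is a window; the left end of the window is excluded
when it is the current time. -/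
theorem after_eq_window (a b : ℕ) (lc rc : Prop) (t : ℝ) :
    Interval.after ⟨a, b, lc, rc⟩ t = window (0 < a ∧ lc) rc (t + a) (t + b) := by
  ext u
  have hb : (∀ c : ℕ, (b : ℕ∞) = c → u - t < c ∨ (rc ∧ u - t = c)) ↔
      (u < t + b ∨ (rc ∧ u = t + b)) := by
    constructor
    · intro h
      have := h b rfl
      rwa [sub_lt_iff_lt_add', sub_eq_iff_eq_add'] at this
    · intro h c hc
      have : b = c := by exact_mod_cast hc
      subst this
      rwa [sub_lt_iff_lt_add', sub_eq_iff_eq_add']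
  simp only [Interval.after, Interval.toSet, window, mem_ofPred_eq, lt_sub_iff_add_lt',
    sub_eq_iff_eq_add', and_assoc]
  rcases Nat.eq_zero_or_pos a with rfl | ha
  · simp only [Nat.cast_zero, add_zero]
    grind
  · have : (0 : ℝ) < a := by exact_mod_cast ha
    simp only [ha, true_and]
    grind

theorem after_top (a : ℕ) (lc rc : Prop) (t : ℝ) :
    Interval.after ⟨a, ⊤, lc, rc⟩ t = {u | t + a < u ∨ ((0 < a ∧ lc) ∧ u = t + a)} := by
  ext u
  simp only [Interval.after, Interval.toSet, mem_ofPred_eq, lt_sub_iff_add_lt',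
    sub_eq_iff_eq_add', ENat.top_ne_natCast, false_imp_iff, imp_true_iff, and_true, and_assoc]
  rcases Nat.eq_zero_or_pos a with rfl | ha
  · simp only [Nat.cast_zero, add_zero]
    grind
  · have : (0 : ℝ) < a := by exact_mod_cast ha
    simp only [ha, true_and]
    grind

/-! ### Truth sets are regulated -/

/-- A set of reals is regulated if membership in it is constant near every real on either side:
its indicator function has one-sided limits everywhere. -/
def Regulated (B : Set ℝ) : Prop :=
  ∀ (s : ℝ) (l : Filter ℝ), l = 𝓝[<] s ∨ l = 𝓝[>] s → (∀ᶠ x in l, x ∈ B) ∨ ∀ᶠ x in l, x ∉ B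

namespace Regulated

variable {B P Q : Set ℝ}

theorem compl (hB : Regulated B) : Regulated Bᶜ := fun s l hl =>
  (hB s l hl).symm.imp id fun h => h.mono fun _ hx => not_not.2 hx

theorem inter (hP : Regulated P) (hQ : Regulated Q) : Regulated (P ∩ Q) := by
  intro s l hl
  rcases hP s l hl with h | h
  · rcases hQ s l hl with h' | h'
    · exact .inl (h.and h')
    · exact .inr (h'.mono fun x hx hx' => hx hx'.2)
  · exact .inr (h.mono fun x hx hx' => hx hx'.1)

theorem of_isLowerSet (hB : IsLowerSet B) : Regulated B := by
  rintro s l (rfl | rfl)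
  · by_cases h : ∃ x, x < s ∧ x ∉ B
    · obtain ⟨x, hx, hxB⟩ := h
      right
      filter_upwards [Ioo_mem_nhdsLT hx] with y hy hyB using hxB (hB hy.1.le hyB)
    · push Not at h
      left
      filter_upwards [self_mem_nhdsWithin] with y hy using h y hy
  · by_cases h : ∃ x, s < x ∧ x ∈ B
    · obtain ⟨x, hx, hxB⟩ := h
      left
      filter_upwards [Ioo_mem_nhdsGT hx] with y hy using hB hy.2.le hxB
    · push Not at h
      right
      filter_upwards [self_mem_nhdsWithin] with y hy using h y hy

theorem of_eventually_iff (h : ∀ (s : ℝ) (l : Filter ℝ), l = 𝓝[<] s ∨ l = 𝓝[>] s →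
    ∃ C : Set ℝ, Regulated C ∧ ∀ᶠ x in l, (x ∈ B ↔ x ∈ C)) : Regulated B := by
  intro s l hl
  obtain ⟨C, hC, hl'⟩ := h s l hl
  refine (hC s l hl).imp (fun h => ?_) (fun h => ?_)
  · filter_upwards [h, hl'] with x h1 h2 using h2.2 h1
  · filter_upwards [h, hl'] with x h1 h2 using fun h3 => h1 (h2.1 h3)

theorem exists_Ioo_right (hB : Regulated B) (s : ℝ) :
    ∃ ε > 0, Ioo s (s + ε) ⊆ B ∨ Ioo s (s + ε) ⊆ Bᶜ := by
  rcases hB s _ (.inr rfl) with h | h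
  all_goals
    obtain ⟨u, hu, h⟩ := mem_nhdsGT_iff_exists_Ioo_subset.1 h
    refine ⟨u - s, sub_pos.2 hu, ?_⟩
    rw [add_sub_cancel]
  · exact .inl h
  · exact .inr h

theorem neg (hB : Regulated B) : Regulated (-B) := by
  have aux : ∀ (s : ℝ) (l l' : Filter ℝ), Tendsto Neg.neg l l' →
      l' = 𝓝[<] (-s) ∨ l' = 𝓝[>] (-s) → (∀ᶠ x in l, x ∈ -B) ∨ ∀ᶠ x in l, x ∉ -B :=
    fun s l l' hl hl' => (hB (-s) l' hl').imp (fun h => hl.eventually h) fun h => hl.eventually h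
  rintro s l (rfl | rfl)
  · exact aux s _ _ tendsto_neg_nhdsLT (.inr rfl)
  · exact aux s _ _ tendsto_neg_nhdsGT (.inl rfl)

end Regulated

theorem natCast_le_encard_of_Ioo_subset {A : Set ℝ} {x y : ℝ} (hxy : x < y) (h : Ioo x y ⊆ A)
    (k : ℕ) : (k : ℕ∞) ≤ A.encard := by
  rw [((Ioo_infinite hxy).mono h).encard_eq]
  exact le_top

/-- The right-hand half of the regulatedness of a sliding count. If `B` fills a right
neighbourhood of one of the two moving ends, the count is infinite; otherwise the set of
counted points does not depend on the position. -/
theorem eventually_right_le_encard_window {B : Set ℝ} (hB : Regulated B) (k : ℕ) (lc rc : Prop)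
    {a b : ℝ} (hab : a < b) (s : ℝ) :
    (∀ᶠ t in 𝓝[>] s, (k : ℕ∞) ≤ (B ∩ window lc rc (t + a) (t + b)).encard) ∨
      ∀ᶠ t in 𝓝[>] s, ¬ (k : ℕ∞) ≤ (B ∩ window lc rc (t + a) (t + b)).encard := by
  obtain ⟨ε, hε, h1⟩ := hB.exists_Ioo_right (s + a)
  obtain ⟨δ, hδ, h2⟩ := hB.exists_Ioo_right (s + b)
  have hmem : Ioo s (s + min (min ε δ) (b - a)) ∈ 𝓝[>] s := by
    refine Ioo_mem_nhdsGT ?_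
    have : 0 < min (min ε δ) (b - a) := lt_min (lt_min hε hδ) (sub_pos.2 hab)
    linarith
  have hlt : ∀ t ∈ Ioo s (s + min (min ε δ) (b - a)),
      s < t ∧ t < s + ε ∧ t < s + δ ∧ t < s + (b - a) := by
    rintro t ⟨h, h'⟩
    have e1 := min_le_left (min ε δ) (b - a)
    have e2 := min_le_right (min ε δ) (b - a)
    have e3 := min_le_left ε δ
    have e4 := min_le_right ε δ
    exact ⟨h, by linarith, by linarith, by linarith⟩
  rcases h1 with h1 | h1
  · left
    filter_upwards [hmem] with t ht
    obtain ⟨ht0, ht1, -, -⟩ := hlt t ht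
    refine natCast_le_encard_of_Ioo_subset (x := t + a) (y := min (s + a + ε) (t + b))
      (lt_min (by linarith) (by linarith)) (fun u hu => ?_) k
    obtain ⟨hu1, hu2⟩ := lt_min_iff.1 hu.2
    exact ⟨h1 ⟨by linarith [hu.1], hu1⟩, Ioo_subset_window _ _ _ _ ⟨hu.1, hu2⟩⟩
  rcases h2 with h2 | h2
  · left
    filter_upwards [hmem] with t ht
    obtain ⟨ht0, -, ht2, ht3⟩ := hlt t ht
    refine natCast_le_encard_of_Ioo_subset (x := max (s + b) (t + a)) (y := t + b)
      (max_lt (by linarith) (by linarith)) (fun u hu => ?_) k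
    obtain ⟨hu1, hu2⟩ := max_lt_iff.1 hu.1
    exact ⟨h2 ⟨hu1, by linarith [hu.2]⟩, Ioo_subset_window _ _ _ _ ⟨hu2, hu.2⟩⟩
  have key : ∀ t ∈ Ioo s (s + min (min ε δ) (b - a)),
      B ∩ window lc rc (t + a) (t + b) = B ∩ Ioc (s + a) (s + b) := by
    intro t ht
    obtain ⟨ht0, ht1, ht2, ht3⟩ := hlt t ht
    ext u
    constructor
    · rintro ⟨hu, hw⟩
      have := window_subset_Icc _ _ _ _ hw
      refine ⟨hu, by linarith [this.1], ?_⟩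
      by_contra hlt
      exact h2 ⟨not_le.1 hlt, by linarith [this.2]⟩ hu
    · rintro ⟨hu, hw⟩
      refine ⟨hu, Ioo_subset_window _ _ _ _ ⟨?_, by linarith [hw.2]⟩⟩
      by_contra hlt
      exact h1 ⟨hw.1, by linarith⟩ hu
  by_cases hk : (k : ℕ∞) ≤ (B ∩ Ioc (s + a) (s + b)).encard
  · left
    filter_upwards [hmem] with t ht
    rwa [key t ht]
  · right
    filter_upwards [hmem] with t ht
    rwa [key t ht]

theorem neg_window (lc rc : Prop) (x y : ℝ) : -window lc rc x y = window rc lc (-y) (-x) := by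
  ext u
  simp only [window, Set.mem_neg, mem_ofPred_eq, neg_lt, lt_neg, neg_eq_iff_eq_neg]
  tauto

namespace Regulated

theorem le_encard_window {B : Set ℝ} (hB : Regulated B) (k : ℕ) (lc rc : Prop)
    {a b : ℝ} (hab : a < b) :
    Regulated {t | (k : ℕ∞) ≤ (B ∩ window lc rc (t + a) (t + b)).encard} := by
  rintro s l (rfl | rfl)
  · -- the left-hand side follows by reflection
    have h := eventually_right_le_encard_window hB.neg k rc lc (neg_lt_neg hab) (-s)
    have key : ∀ t : ℝ, (-B ∩ window rc lc (-t + -b) (-t + -a)).encard =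
        (B ∩ window lc rc (t + a) (t + b)).encard := by
      intro t
      rw [← neg_add, ← neg_add, ← neg_window, ← Set.inter_neg, ← Set.image_neg_eq_neg,
        neg_injective.encard_image]
    have ht : Tendsto Neg.neg (𝓝[<] s) (𝓝[>] (-s)) := tendsto_neg_nhdsLT
    refine h.imp (fun h => ?_) fun h => ?_
    · filter_upwards [ht.eventually h] with t ht
      rwa [key] at ht
    · filter_upwards [ht.eventually h] with t ht
      rwa [key] at ht
  · exact eventually_right_le_encard_window hB k lc rc hab s

theorem countSet {B : Set ℝ} (hB : Regulated B) (k : ℕ) {I : Interval}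
    (hI : I ∈ Interval.nonSingular) : Regulated (countSet k I B) := by
  obtain ⟨a, b, lc, rc⟩ := I
  induction b using ENat.recTopCoe with
  | top =>
    refine of_isLowerSet fun x y hyx hx => le_trans (b := _) hx (encard_le_encard ?_)
    rw [after_top, after_top]
    refine inter_subset_inter_right _ fun u hu => ?_
    rcases hyx.lt_or_eq with h | rfl
    · left
      rcases hu with hu | ⟨-, rfl⟩ <;> linarith
    · exact hu
  | coe b =>
    have hab : (a : ℝ) < b := by
      have : (a : ℕ∞) < b := hI
      exact_mod_cast this
    simp only [TimedLogic.countSet, after_eq_window]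
    exact hB.le_encard_window k _ _ hab

theorem untilSet {P Q : Set ℝ} (hP : Regulated P) (hQ : Regulated Q) {I : Interval}
    (hI : I ∈ Interval.nonSingular) : Regulated (untilSet I P Q) := by
  refine of_eventually_iff fun s l hl => ?_
  -- `P` is constant on an interval `(c, d)` adjacent to `s`
  have hcd : ∃ c d, Ioo c d ∈ l ∧ (Ioo c d ⊆ P ∨ Ioo c d ⊆ Pᶜ) := by
    have aux : ∀ C : Set ℝ, C ∈ l → ∃ c d, Ioo c d ∈ l ∧ Ioo c d ⊆ C := by
      intro C hC
      rcases hl with rfl | rfl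
      · obtain ⟨c, hc, h⟩ := mem_nhdsLT_iff_exists_Ioo_subset.1 hC
        exact ⟨c, s, Ioo_mem_nhdsLT hc, h⟩
      · obtain ⟨c, hc, h⟩ := mem_nhdsGT_iff_exists_Ioo_subset.1 hC
        exact ⟨s, c, Ioo_mem_nhdsGT hc, h⟩
    rcases hP s l hl with h | h
    · obtain ⟨c, d, h1, h2⟩ := aux _ h
      exact ⟨c, d, h1, .inl h2⟩
    · obtain ⟨c, d, h1, h2⟩ := aux _ h
      exact ⟨c, d, h1, .inr h2⟩
  obtain ⟨c, d, hl', h | h⟩ := hcd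
  · have hW : IsLowerSet {u : ℝ | Ioo c u ⊆ P} := fun x y hyx hx =>
      (Ioo_subset_Ioo_right hyx).trans hx
    refine ⟨_, (hQ.inter (of_isLowerSet hW)).countSet 1 hI, ?_⟩
    filter_upwards [hl'] with t ht
    simp only [TimedLogic.untilSet, TimedLogic.countSet, mem_ofPred_eq, Nat.cast_one,
      one_le_encard_iff_nonempty, Set.Nonempty, Interval.after, mem_inter_iff]
    refine exists_congr fun u => ?_
    have : Ioo t u ⊆ P ↔ Ioo c u ⊆ P := by
      constructor
      · intro h' x hx
        rcases lt_or_ge t x with hx' | hx'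
        · exact h' ⟨hx', hx.2⟩
        · exact h ⟨hx.1, hx'.trans_lt ht.2⟩
      · exact (Ioo_subset_Ioo_left ht.1.le).trans
    rw [this]
    tauto
  · refine ⟨∅, of_isLowerSet (isLowerSet_empty), ?_⟩
    filter_upwards [hl'] with t ht
    refine iff_of_false ?_ (notMem_empty t)
    rintro ⟨u, htu, -, -, hu⟩
    obtain ⟨x, hx1, hx2⟩ := exists_between (lt_min htu ht.2)
    obtain ⟨hxu, hxd⟩ := lt_min_iff.1 hx2
    exact h ⟨ht.1.trans hx1, hxd⟩ (hu ⟨hx1, hxu⟩)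

end Regulated

/-- The truth set of a formula in a signal. -/
def truthSet (f : Signal AP) (φ : Formula AP) : Set ℝ := {x | ∃ t : ℝ≥0, (t : ℝ) = x ∧ Sat f φ t}

theorem represents_truthSet (f : Signal AP) (φ : Formula AP) :
    Represents f φ (truthSet f φ) := by
  intro t
  constructor
  · exact fun h => ⟨t, rfl, h⟩
  · rintro ⟨u, hu, h⟩
    rwa [← NNReal.coe_injective hu]

theorem Represents.truthSet_eq {f : Signal AP} {φ : Formula AP} {S : Set ℝ}
    (h : Represents f φ S) : truthSet f φ = S ∩ Ici 0 := by
  ext x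
  constructor
  · rintro ⟨t, rfl, ht⟩
    exact ⟨(h t).1 ht, t.2⟩
  · rintro ⟨hx, hx0⟩
    lift x to ℝ≥0 using hx0
    exact ⟨x, rfl, (h x).2 hx⟩

theorem regulated_Ici_zero : Regulated (Ici 0) := by
  have h : IsLowerSet (Iio (0 : ℝ)) := isLowerSet_Iio 0
  simpa using (Regulated.of_isLowerSet h).compl

theorem mem_iff_mem_of_locally_constant {B : Set ℝ} {c d : ℝ}
    (h : ∀ x ∈ Ioo c d, ∀ᶠ y in 𝓝 x, (y ∈ B ↔ x ∈ B)) {x y : ℝ} (hx : x ∈ Ioo c d)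
    (hy : y ∈ Ioo c d) (hxB : x ∈ B) : y ∈ B := by
  classical
  have hcont : ContinuousOn (fun z => decide (z ∈ B)) (Ioo c d) := by
    intro z hz
    refine ContinuousAt.continuousWithinAt (tendsto_nhds_of_eventually_eq ?_)
    filter_upwards [h z hz] with w hw
    simp [hw]
  simpa [hxB] using isPreconnected_Ioo.constant hcont hx hy

theorem regulated_of_locally_constant {B : Set ℝ}
    (h : ∀ s, ∀ᶠ x in 𝓝[≠] s, ∀ᶠ y in 𝓝 x, (y ∈ B ↔ x ∈ B)) : Regulated B := by
  have aux : ∀ (l : Filter ℝ) (c d : ℝ), Ioo c d ∈ l →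
      (∀ x ∈ Ioo c d, ∀ᶠ y in 𝓝 x, (y ∈ B ↔ x ∈ B)) →
      (∀ᶠ x in l, x ∈ B) ∨ ∀ᶠ x in l, x ∉ B := by
    intro l c d hl hc
    by_cases hB : ∃ x ∈ Ioo c d, x ∈ B
    · obtain ⟨x, hx, hxB⟩ := hB
      left
      filter_upwards [hl] with y hy using mem_iff_mem_of_locally_constant hc hx hy hxB
    · right
      filter_upwards [hl] with y hy using fun hyB => hB ⟨y, hy, hyB⟩
  rintro s l (rfl | rfl)
  · obtain ⟨c, hc, hs⟩ := mem_nhdsLT_iff_exists_Ioo_subset.1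
      ((h s).filter_mono (nhdsWithin_mono s fun x hx => ne_of_lt hx))
    exact aux _ c s (Ioo_mem_nhdsLT hc) hs
  · obtain ⟨c, hc, hs⟩ := mem_nhdsGT_iff_exists_Ioo_subset.1
      ((h s).filter_mono (nhdsWithin_mono s fun x hx => ne_of_gt hx))
    exact aux _ s c (Ioo_mem_nhdsGT hc) hs

/-- The times at which an atomic proposition holds form a regulated set: next to any time
there is an interval without discontinuities of the signal, on which the signal is constant. -/
theorem regulated_truthSet_atom (f : Signal AP) (p : AP) : Regulated (truthSet f (.atom p)) := by
  refine regulated_of_locally_constant fun s => ?_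
  -- the exceptional times near `s` are discontinuities of the signal, or `0`
  set D : Set ℝ := insert 0 ((fun t : ℝ≥0 => (t : ℝ)) ''
    {t : ℝ≥0 | t ≤ Real.toNNReal (s + 1) ∧ ¬ ∀ᶠ u in 𝓝 t, f.val u = f.val t}) with hD
  have hfin : D.Finite := ((f.finitelyVariable _).image _).insert 0
  have hev : ∀ᶠ x in 𝓝[≠] s, x ∉ D := by
    have : (D \ {s})ᶜ ∈ 𝓝 s :=
      (hfin.subset sdiff_subset).isClosed.isOpen_compl.mem_nhds (by simp)
    filter_upwards [nhdsWithin_le_nhds this, self_mem_nhdsWithin] with x hx hxs hxD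
    exact hx ⟨hxD, hxs⟩
  filter_upwards [hev, nhdsWithin_le_nhds (Iio_mem_nhds (lt_add_one s))] with x hx hxs
  have hx0 : x ≠ 0 := fun h => hx (h ▸ mem_insert _ _)
  rcases hx0.lt_or_gt with hneg | hpos
  · have hout : ∀ y < 0, y ∉ truthSet f (.atom p) := by
      rintro _ hy ⟨t, rfl, -⟩
      exact absurd t.2 (not_le.2 hy)
    filter_upwards [Iio_mem_nhds hneg] with y hy using iff_of_false (hout y hy) (hout x hneg)
  · lift x to ℝ≥0 using hpos.le
    have hc : ∀ᶠ u in 𝓝 x, f.val u = f.val x := by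
      by_contra hc
      exact hx (mem_insert_of_mem _ ⟨x, ⟨NNReal.le_toNNReal_of_coe_le (le_of_lt hxs), hc⟩, rfl⟩)
    have ht : Tendsto Real.toNNReal (𝓝 (x : ℝ)) (𝓝 x) := by
      have := (continuous_real_toNNReal.tendsto (x : ℝ))
      rwa [Real.toNNReal_coe] at this
    filter_upwards [ht.eventually hc, Ioi_mem_nhds hpos] with y hy hy0
    have h1 := represents_truthSet f (.atom p) x
    have h2 := represents_truthSet f (.atom p) y.toNNReal
    rw [Real.coe_toNNReal y (le_of_lt hy0)] at h2
    rw [← h1, ← h2]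
    change p ∈ f.val _ ↔ p ∈ f.val _
    rw [hy]

theorem regulated_truthSet (f : Signal AP) {U C : Set Interval} (hU : U ⊆ Interval.nonSingular)
    (hC : C ⊆ Interval.nonSingular) {φ : Formula AP} (hφ : φ.Uses U C) :
    Regulated (truthSet f φ) := by
  induction φ with
  | top =>
    have h : Represents f .top Set.univ := fun t => Iff.rfl
    rw [h.truthSet_eq, univ_inter]
    exact regulated_Ici_zero
  | atom p => exact regulated_truthSet_atom f p
  | and φ ψ ihφ ihψ =>
    have h : Represents f (.and φ ψ) (truthSet f φ ∩ truthSet f ψ) := fun t =>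
      and_congr (represents_truthSet f φ t) (represents_truthSet f ψ t)
    rw [h.truthSet_eq]
    exact ((ihφ hφ.1).inter (ihψ hφ.2)).inter regulated_Ici_zero
  | neg φ ih =>
    have h : Represents f (.neg φ) (truthSet f φ)ᶜ := fun t =>
      not_congr (represents_truthSet f φ t)
    rw [h.truthSet_eq]
    exact (ih hφ).compl.inter regulated_Ici_zero
  | untl I φ ψ ihφ ihψ =>
    rw [((represents_truthSet f φ).untl (represents_truthSet f ψ) I).truthSet_eq]
    exact ((ihφ hφ.2.1).untilSet (ihψ hφ.2.2) (hU hφ.1)).inter regulated_Ici_zero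
  | count k I φ ih =>
    rw [((represents_truthSet f φ).count k I).truthSet_eq]
    exact ((ih hφ.2).countSet k (hC hφ.1)).inter regulated_Ici_zero

/-! ### Counting jumps modulo two -/

/-- Counting jumps modulo two recovers the value of a regulated set: if `L` and `R` are the left
and the right limits of `D`, then membership of `c` in `D` differs from the right limit at `t` iff
the number of jumps in between is odd. A jump can occur on either side of a time, so jumps
from the left limit to the value are counted on `(t, c]` and those from the value to the
right limit on `(t, c)`. -/
theorem mem_iff_odd_jumps {D L R : Set ℝ} (hL : ∀ s, ∀ᶠ x in 𝓝[<] s, (x ∈ D ↔ s ∈ L))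
    (hR : ∀ s, ∀ᶠ x in 𝓝[>] s, (x ∈ D ↔ s ∈ R)) {t c : ℝ} (htc : t < c)
    (hEL : ({s | ¬ (s ∈ L ↔ s ∈ D)} ∩ Ioc t c).Finite)
    (hER : ({s | ¬ (s ∈ D ↔ s ∈ R)} ∩ Ioo t c).Finite) :
    c ∈ D ↔ ((t ∈ R ↔ Odd ({s | ¬ (s ∈ L ↔ s ∈ D)} ∩ Ioc t c).ncard) ↔
      Odd ({s | ¬ (s ∈ D ↔ s ∈ R)} ∩ Ioo t c).ncard) := by
  set EL := {s | ¬ (s ∈ L ↔ s ∈ D)} with hELdef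
  set ER := {s | ¬ (s ∈ D ↔ s ∈ R)} with hERdef
  -- without jumps strictly between `s` and `c`, the limits at the two ends agree
  have hconst : ∀ {s c : ℝ}, s < c → (EL ∪ ER) ∩ Ioo s c = ∅ → (s ∈ R ↔ c ∈ L) := by
    intro s c hsc hempty
    have hloc : ∀ x ∈ Ioo s c, ∀ᶠ y in 𝓝 x, (y ∈ D ↔ x ∈ D) := by
      intro x hx
      have hx' : x ∉ EL ∪ ER := fun h => (hempty.subset ⟨h, hx⟩ : x ∈ (∅ : Set ℝ))
      simp only [hELdef, hERdef, mem_union, mem_ofPred_eq, not_or, not_not] at hx'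
      rw [← nhdsNE_sup_pure, ← nhdsLT_sup_nhdsGT, eventually_sup, eventually_sup]
      refine ⟨⟨?_, ?_⟩, ?_⟩
      · filter_upwards [hL x] with y hy using hy.trans hx'.1
      · filter_upwards [hR x] with y hy using hy.trans hx'.2.symm
      · exact Iff.rfl
    obtain ⟨x, hx, hxR⟩ := ((hR s).and (Ioo_mem_nhdsGT hsc)).exists
    obtain ⟨y, hy, hyL⟩ := ((hL c).and (Ioo_mem_nhdsLT hsc)).exists
    rw [← hx, ← hy]
    exact ⟨mem_iff_mem_of_locally_constant hloc hxR hyL,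
      mem_iff_mem_of_locally_constant hloc hyL hxR⟩
  have hsingle : ∀ (E : Set ℝ) (s : ℝ), Odd (E ∩ {s}).ncard ↔ s ∈ E := by
    intro E s
    by_cases hs : s ∈ E
    · simp [hs]
    · simp [hs]
  have hunion : ∀ {A B C : Set ℝ}, A.Finite → A = B ∪ C → Disjoint B C →
      (Odd A.ncard ↔ ¬ (Odd B.ncard ↔ Odd C.ncard)) := by
    rintro A B C hA rfl hdisj
    rw [ncard_union_eq hdisj (hA.subset subset_union_left) (hA.subset subset_union_right),
      Nat.odd_add, ← Nat.not_odd_iff_even]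
    tauto
  have hJ : ((EL ∪ ER) ∩ Ioo t c).Finite := by
    rw [union_inter_distrib_right]
    exact (hEL.subset (inter_subset_inter_right _ Ioo_subset_Ioc_self)).union hER
  -- induction on the number of times of jumps strictly between `t` and `c`
  induction hn : ((EL ∪ ER) ∩ Ioo t c).ncard using Nat.strong_induction_on generalizing c with
  | _ n ih =>
  rcases eq_empty_or_nonempty ((EL ∪ ER) ∩ Ioo t c) with hempty | hne
  · have h1 : EL ∩ Ioc t c = EL ∩ {c} := by
      ext x
      constructor
      · rintro ⟨hx, hx'⟩
        refine ⟨hx, hx'.2.eq_or_lt.resolve_right fun hlt => ?_⟩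
        exact (hempty.subset ⟨.inl hx, hx'.1, hlt⟩ : x ∈ (∅ : Set ℝ))
      · rintro ⟨hx, rfl⟩
        exact ⟨hx, htc, le_rfl⟩
    have h2 : ER ∩ Ioo t c = ∅ := by
      rw [eq_empty_iff_forall_notMem]
      exact fun x hx => (hempty.subset ⟨.inr hx.1, hx.2⟩ : x ∈ (∅ : Set ℝ))
    rw [h1, h2, hsingle, hconst htc hempty]
    simp only [hELdef, mem_ofPred_eq, ncard_empty, Nat.not_odd_zero]
    tauto
  · obtain ⟨s, ⟨hsJ, hts, hsc⟩, hmax⟩ := hJ.exists_maximalFor id _ hne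
    have hlast : (EL ∪ ER) ∩ Ioo s c = ∅ := by
      rw [eq_empty_iff_forall_notMem]
      rintro x ⟨hx, hsx, hxc⟩
      exact absurd (hmax ⟨hx, hts.trans hsx, hxc⟩ hsx.le) (not_le.2 hsx)
    have hsub : (EL ∪ ER) ∩ Ioo t s ⊂ (EL ∪ ER) ∩ Ioo t c := by
      refine ⟨inter_subset_inter_right _ (Ioo_subset_Ioo_right hsc.le), fun h => ?_⟩
      exact lt_irrefl s (h ⟨hsJ, hts, hsc⟩).2.2
    have h1 : EL ∩ Ioc t c = (EL ∩ Ioc t s) ∪ (EL ∩ {c}) := by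
      ext x
      constructor
      · rintro ⟨hx, hx'⟩
        rcases le_or_gt x s with hxs | hxs
        · exact .inl ⟨hx, hx'.1, hxs⟩
        · refine .inr ⟨hx, hx'.2.eq_or_lt.resolve_right fun hlt => ?_⟩
          exact (hlast.subset ⟨.inl hx, hxs, hlt⟩ : x ∈ (∅ : Set ℝ))
      · rintro (⟨hx, hx'⟩ | ⟨hx, rfl⟩)
        · exact ⟨hx, hx'.1, hx'.2.trans hsc.le⟩
        · exact ⟨hx, htc, le_rfl⟩
    have h2 : ER ∩ Ioo t c = (ER ∩ Ioo t s) ∪ (ER ∩ {s}) := by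
      ext x
      constructor
      · rintro ⟨hx, hx'⟩
        rcases lt_trichotomy x s with hxs | hxs | hxs
        · exact .inl ⟨hx, hx'.1, hxs⟩
        · exact .inr ⟨hx, hxs⟩
        · exact ((hlast.subset ⟨.inr hx, hxs, hx'.2⟩ : x ∈ (∅ : Set ℝ))).elim
      · rintro (⟨hx, hx'⟩ | ⟨hx, rfl⟩)
        · exact ⟨hx, hx'.1, hx'.2.trans hsc⟩
        · exact ⟨hx, hts, hsc⟩
    have d1 : Disjoint (EL ∩ Ioc t s) (EL ∩ {c}) := by
      rw [disjoint_left]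
      rintro x ⟨-, -, hx⟩ ⟨-, rfl⟩
      exact absurd hx (not_le.2 hsc)
    have d2 : Disjoint (ER ∩ Ioo t s) (ER ∩ {s}) := by
      rw [disjoint_left]
      rintro x ⟨-, -, hx⟩ ⟨-, rfl⟩
      exact lt_irrefl _ hx
    have hs := ih _ (hn ▸ ncard_lt_ncard hsub hJ) hts
      (hEL.subset (h1 ▸ subset_union_left)) (hER.subset (h2 ▸ subset_union_left))
      (hJ.subset hsub.1) rfl
    have hc := hconst hsc hlast
    rw [hunion hEL h1 d1, hunion hER h2 d2, hsingle, hsingle]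
    have e1 : c ∈ EL ↔ ¬ (c ∈ L ↔ c ∈ D) := Iff.rfl
    have e2 : s ∈ ER ↔ ¬ (s ∈ D ↔ s ∈ R) := Iff.rfl
    clear_value EL ER
    clear ih hconst hsingle hunion hL hR hELdef hERdef
    grind

/-! ### Shifted unit windows over discrete sets -/

theorem natCast_le_add_one_iff (k : ℕ) (n : ℕ∞) :
    (k : ℕ∞) ≤ n + 1 ↔ ((k - 1 : ℕ) : ℕ∞) ≤ n := by
  rw [ENat.natCast_sub, Nat.cast_one, tsub_le_iff_right]

/-- A window is the window without its left end, together with that end if it is included. -/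
theorem le_encard_inter_window_iff (Q : Set ℝ) (k : ℕ) (lc rc : Prop) {x y : ℝ} (hxy : x < y) :
    (k : ℕ∞) ≤ (Q ∩ window lc rc x y).encard ↔ (k : ℕ∞) ≤ (Q ∩ window False rc x y).encard ∨
      (lc ∧ x ∈ Q ∧ ((k - 1 : ℕ) : ℕ∞) ≤ (Q ∩ window False rc x y).encard) := by
  by_cases h : lc ∧ x ∈ Q
  · have h1 : Q ∩ window lc rc x y = insert x (Q ∩ window False rc x y) := by
      ext u
      simp only [window, mem_inter_iff, mem_insert_iff, mem_ofPred_eq]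
      grind
    have h2 : x ∉ Q ∩ window False rc x y := by simp [window]
    rw [h1, encard_insert_of_notMem h2, natCast_le_add_one_iff]
    have h3 : (k : ℕ∞) ≤ (Q ∩ window False rc x y).encard →
        ((k - 1 : ℕ) : ℕ∞) ≤ (Q ∩ window False rc x y).encard :=
      le_trans (by exact_mod_cast Nat.sub_le k 1)
    tauto
  · have h1 : Q ∩ window lc rc x y = Q ∩ window False rc x y := by
      ext u
      simp only [window, mem_inter_iff, mem_ofPred_eq]
      grind
    rw [h1]
    tauto

namespace Expressible

variable {S : Signal AP → Set ℝ}

theorem exists_mem_window (hS : Expressible S) (lc rc : Prop) {a b : ℕ} (ha : 0 < a)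
    (hab : a < b) :
    Expressible fun f => {t | ∃ u ∈ window lc rc (t + a) (t + b), u ∈ S f} := by
  have hI : (⟨a, b, lc, rc⟩ : Interval) ∈ Interval.nonSingular := by
    change (a : ℕ∞) < b
    exact_mod_cast hab
  refine (Expressible.univ.untl hI hS).congr fun f t _ => ?_
  have := after_eq_window a b lc rc t
  simp only [ha, true_and] at this
  simp only [← this, mem_ofPred_eq, untilSet, Interval.after, subset_univ, and_true, and_assoc]

theorem le_encard_window (hS : Expressible S) (k : ℕ) (rc : Prop) {b : ℕ} (hb : 0 < b) :
    Expressible fun f => {t | (k : ℕ∞) ≤ (S f ∩ window False rc t (t + b)).encard} := by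
  have hI : (⟨0, b, True, rc⟩ : Interval) ∈ Interval.zeroBased :=
    ⟨show ((0 : ℕ) : ℕ∞) < b by exact_mod_cast hb, rfl, trivial⟩
  refine (hS.count hI k).congr fun f t _ => ?_
  have := after_eq_window 0 b True rc t
  simp only [lt_irrefl, false_and, Nat.cast_zero, add_zero] at this
  simp only [countSet, mem_ofPred_eq, this]

/-- The parity of a uniformly bounded count is expressible, since the count can be determined
exactly. -/
theorem odd_ncard_window (hS : Expressible S) (rc : Prop) {b : ℕ} (hb : 0 < b) {N : ℕ}
    (hN : ∀ f t, (S f ∩ window False rc t (t + b)).encard ≤ N) :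
    Expressible fun f => {t | Odd (S f ∩ window False rc t (t + b)).ncard} := by
  refine (exists_lt (N + 1) fun i => (const (Odd i)).inter ((hS.le_encard_window i rc hb).inter
    (hS.le_encard_window (i + 1) rc hb).compl)).congr fun f t _ => ?_
  obtain ⟨hfin, hle⟩ := encard_le_coe_iff_finite_ncard_le.1 (hN f t)
  simp only [mem_ofPred_eq, mem_inter_iff, mem_compl_iff, ← hfin.cast_ncard_eq, Nat.cast_le]
  constructor
  · rintro ⟨i, hi, hodd, h1, h2⟩
    rwa [show i = (S f ∩ window False rc t (t + b)).ncard by omega] at hodd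
  · intro h
    exact ⟨_, by omega, h, le_rfl, by omega⟩

end Expressible

/-- A set of reals is discrete (and closed) if every real has a punctured neighbourhood
disjoint from it. -/
def LocallySparse (Q : Set ℝ) : Prop := ∀ s, ∀ᶠ x in 𝓝[≠] s, x ∉ Q

theorem LocallySparse.exists_pos {Q : Set ℝ} (hQ : LocallySparse Q) (s : ℝ) :
    ∃ ε > 0, ∀ x ∈ Q, |x - s| < ε → x = s := by
  obtain ⟨ε, hε, h⟩ := Metric.eventually_nhds_iff.1 (eventually_nhdsWithin_iff.1 (hQ s))
  exact ⟨ε, hε, fun x hx hxs => by_contra fun hne => h (by rwa [Real.dist_eq]) hne hx⟩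

/-- For a discrete set, the left limit of the set of points in a sliding unit window is given by
the window closed on the left and open on the right. -/
theorem LocallySparse.eventually_left {Q : Set ℝ} (hQ : LocallySparse Q) (lc rc : Prop) (s : ℝ) :
    ∀ᶠ x in 𝓝[<] s, Q ∩ window lc rc x (x + 1) = Q ∩ window True False s (s + 1) := by
  obtain ⟨ε, hε, h1⟩ := hQ.exists_pos s
  obtain ⟨δ, hδ, h2⟩ := hQ.exists_pos (s + 1)
  have hpos : 0 < min (min ε δ) 1 := lt_min (lt_min hε hδ) one_pos
  filter_upwards [Ioo_mem_nhdsLT (sub_lt_self s hpos)] with x hx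
  have hx1 := hx.1
  have hx2 := hx.2
  have e1 := min_le_left (min ε δ) 1
  have e2 := min_le_right (min ε δ) 1
  have e3 := min_le_left ε δ
  have e4 := min_le_right ε δ
  ext u
  refine and_congr_right fun hu => ⟨fun hw => ?_, fun hw => ?_⟩
  · have hw := window_subset_Icc _ _ _ _ hw
    refine ⟨?_, .inl (by linarith [hw.2])⟩
    rcases lt_or_ge s u with h | h
    · exact .inl h
    · exact .inr ⟨trivial, h1 u hu (abs_lt.2 ⟨by linarith [hw.1], by linarith⟩)⟩
  · obtain ⟨hw1, hw2 | hw2⟩ := hw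
    · refine Ioo_subset_window _ _ _ _ ⟨?_, ?_⟩
      · rcases hw1 with h | h
        · linarith
        · linarith [h.2]
      · by_contra hlt
        have := h2 u hu (abs_lt.2 ⟨by linarith, by linarith⟩)
        linarith
    · exact hw2.1.elim

/-- For a discrete set, the right limit of the set of points in a sliding unit window is given
by the window open on the left and closed on the right. -/
theorem LocallySparse.eventually_right {Q : Set ℝ} (hQ : LocallySparse Q) (lc rc : Prop) (s : ℝ) :
    ∀ᶠ x in 𝓝[>] s, Q ∩ window lc rc x (x + 1) = Q ∩ window False True s (s + 1) := by
  obtain ⟨ε, hε, h1⟩ := hQ.exists_pos s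
  obtain ⟨δ, hδ, h2⟩ := hQ.exists_pos (s + 1)
  have hpos : 0 < min (min ε δ) 1 := lt_min (lt_min hε hδ) one_pos
  filter_upwards [Ioo_mem_nhdsGT (lt_add_of_pos_right s hpos)] with x hx
  have hx1 := hx.1
  have hx2 := hx.2
  have e1 := min_le_left (min ε δ) 1
  have e2 := min_le_right (min ε δ) 1
  have e3 := min_le_left ε δ
  have e4 := min_le_right ε δ
  ext u
  refine and_congr_right fun hu => ⟨fun hw => ?_, fun hw => ?_⟩
  · have hw := window_subset_Icc _ _ _ _ hw
    refine ⟨.inl (by linarith [hw.1]), ?_⟩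
    rcases lt_or_ge u (s + 1) with h | h
    · exact .inl h
    · exact .inr ⟨trivial, h2 u hu (abs_lt.2 ⟨by linarith, by linarith [hw.2]⟩)⟩
  · obtain ⟨hw1 | hw1, hw2⟩ := hw
    · refine Ioo_subset_window _ _ _ _ ⟨?_, ?_⟩
      · by_contra hlt
        have := h1 u hu (abs_lt.2 ⟨by linarith, by linarith⟩)
        linarith
      · rcases hw2 with h | h
        · linarith
        · linarith [h.2]
    · exact hw1.1.elim

/-- The positions `s` at which the truth value of "at least `k` points of `Q` lie in the unit
window at `s`" can depend on which ends belong to the window. -/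
def criticalSites (Q : Set ℝ) (k : ℕ) : Set ℝ :=
  {s | ¬ (k : ℕ∞) ≤ (Q ∩ Ioo s (s + 1)).encard ∧ (s ∈ Q ∨ s + 1 ∈ Q)}

theorem mem_criticalSites {Q : Set ℝ} {k : ℕ} {lc rc lc' rc' : Prop} {s : ℝ}
    (h : ¬ ((k : ℕ∞) ≤ (Q ∩ window lc rc s (s + 1)).encard ↔
      (k : ℕ∞) ≤ (Q ∩ window lc' rc' s (s + 1)).encard)) : s ∈ criticalSites Q k := by
  refine ⟨fun hk => h ?_, ?_⟩
  · have : ∀ lc rc : Prop, (k : ℕ∞) ≤ (Q ∩ window lc rc s (s + 1)).encard := fun lc rc =>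
      hk.trans (encard_le_encard (inter_subset_inter_right _ (Ioo_subset_window _ _ _ _)))
    exact iff_of_true (this _ _) (this _ _)
  · by_contra! hs
    refine h ?_
    have : Q ∩ window lc rc s (s + 1) = Q ∩ window lc' rc' s (s + 1) := by
      ext u
      refine and_congr_right fun hu => ?_
      have h1 : u ≠ s := fun h => hs.1 (h ▸ hu)
      have h2 : u ≠ s + 1 := fun h => hs.2 (h ▸ hu)
      simp [window, h1, h2]
    rw [this]

/-- In a window of length one there are at most `2k` critical sites: if `s` is the least of more
than `k` sites that belong to `Q`, the others are points of `Q` in `(s, s + 1)`; if `s` is the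
greatest of more than `k` sites preceding a point of `Q` by one, the others yield points of `Q` in
`(s, s + 1)` when shifted by one. -/
theorem encard_criticalSites_inter_Ioc_le (Q : Set ℝ) (k : ℕ) (c : ℝ) :
    (criticalSites Q k ∩ Ioc c (c + 1)).encard ≤ (2 * k : ℕ) := by
  have aux : ∀ A : Set ℝ, (∀ F ⊆ A, F.Finite → F.Nonempty →
      ∃ m ∈ F, ¬ (k : ℕ∞) ≤ (F \ {m}).encard) → A.encard ≤ k := by
    intro A hA
    by_contra! hlt
    have : ((k + 1 : ℕ) : ℕ∞) ≤ A.encard := by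
      rw [Nat.cast_add, Nat.cast_one]
      exact Order.add_one_le_of_lt hlt
    obtain ⟨F, hFA, hF⟩ := exists_subset_encard_eq this
    have hne : F.Nonempty := by
      rw [← encard_pos, hF]
      exact_mod_cast Nat.succ_pos k
    obtain ⟨m, hm, hk⟩ := hA F hFA (finite_of_encard_eq_coe hF) hne
    refine hk ?_
    have := (natCast_le_add_one_iff (k + 1) (F \ {m}).encard).1
    rw [encard_sdiff_singleton_add_one hm] at this
    exact this hF.ge
  have h1 : ({s | ¬ (k : ℕ∞) ≤ (Q ∩ Ioo s (s + 1)).encard ∧ s ∈ Q} ∩ Ioc c (c + 1)).encard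
      ≤ k := by
    refine aux _ fun F hF hfin hne => ?_
    obtain ⟨m, hm, hmin⟩ := hfin.exists_minimalFor id F hne
    refine ⟨m, hm, fun hk => (hF hm).1.1 (hk.trans (encard_le_encard ?_))⟩
    rintro x ⟨hx, hxm⟩
    have hmx : m < x := lt_of_le_of_ne (le_of_not_gt fun h => not_lt.2 (hmin hx h.le) h)
      (Ne.symm hxm)
    exact ⟨(hF hx).1.2, hmx, by linarith [(hF hx).2.2, (hF hm).2.1]⟩
  have h2 : ({s | ¬ (k : ℕ∞) ≤ (Q ∩ Ioo s (s + 1)).encard ∧ s + 1 ∈ Q} ∩ Ioc c (c + 1)).encard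
      ≤ k := by
    refine aux _ fun F hF hfin hne => ?_
    obtain ⟨m, hm, hmax⟩ := hfin.exists_maximalFor id F hne
    refine ⟨m, hm, fun hk => (hF hm).1.1 (hk.trans ?_)⟩
    rw [← (add_left_injective (1 : ℝ)).encard_image (F \ {m})]
    refine encard_le_encard ?_
    rintro _ ⟨x, ⟨hx, hxm⟩, rfl⟩
    have hmx : x < m := lt_of_le_of_ne (le_of_not_gt fun h => not_lt.2 (hmax hx h.le) h) hxm
    exact ⟨(hF hx).1.2, by linarith [(hF hx).2.1, (hF hm).2.2], by linarith⟩
  have h3 : criticalSites Q k ∩ Ioc c (c + 1) ⊆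
      ({s | ¬ (k : ℕ∞) ≤ (Q ∩ Ioo s (s + 1)).encard ∧ s ∈ Q} ∩ Ioc c (c + 1)) ∪
      ({s | ¬ (k : ℕ∞) ≤ (Q ∩ Ioo s (s + 1)).encard ∧ s + 1 ∈ Q} ∩ Ioc c (c + 1)) := by
    rintro s ⟨⟨hs, h | h⟩, hc⟩
    · exact .inl ⟨⟨hs, h⟩, hc⟩
    · exact .inr ⟨⟨hs, h⟩, hc⟩
  refine (encard_le_encard h3).trans ((encard_union_le _ _).trans ?_)
  rw [two_mul, Nat.cast_add]
  exact add_le_add h1 h2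

theorem encard_criticalSites_inter_Ioc_natCast_le (Q : Set ℝ) (k a : ℕ) (c : ℝ) :
    (criticalSites Q k ∩ Ioc c (c + a)).encard ≤ (2 * k * a : ℕ) := by
  induction a with
  | zero => simp
  | succ a ih =>
    have h : Ioc c (c + (a + 1 : ℕ)) ⊆ Ioc c (c + a) ∪ Ioc (c + a) (c + a + 1) := by
      push_cast
      rw [← add_assoc]
      exact Ioc_subset_Ioc_union_Ioc
    refine (encard_le_encard ((inter_subset_inter_right _ h).trans_eq
      (inter_union_distrib_left _ _ _))).trans ((encard_union_le _ _).trans ?_)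
    rw [Nat.mul_succ, Nat.cast_add]
    exact add_le_add ih (encard_criticalSites_inter_Ioc_le Q k _)

/-- Counting the points of a discrete set in a unit window shifted by `a` is expressible, although
no modality refers to the exact distance `a`: the value at the current time is known, and the
parity of the number of jumps on the way is computed by the counting modalities. The
limits from both sides are themselves values of formulae about the future, so the jumps are
expressible. -/
theorem Expressible.le_encard_shifted_unit_window {Q : Signal AP → Set ℝ} (hQ : Expressible Q)
    (hsparse : ∀ f, LocallySparse (Q f)) (k : ℕ) (lc rc : Prop) {a : ℕ} (ha : 0 < a) :
    Expressible fun f =>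
      {t | (k : ℕ∞) ≤ (Q f ∩ window lc rc (t + a) (t + a + 1)).encard} := by
  -- `D lc rc` is the unit window count at the current time
  let D : Prop → Prop → Signal AP → Set ℝ := fun lc rc f =>
    {s | (k : ℕ∞) ≤ (Q f ∩ window lc rc s (s + 1)).encard}
  have hD : ∀ lc rc, Expressible (D lc rc) := by
    intro lc rc
    have h : ∀ k : ℕ, Expressible fun f =>
        {t | (k : ℕ∞) ≤ (Q f ∩ window False rc t (t + 1)).encard} := fun k => by
      simpa using hQ.le_encard_window k rc one_pos
    refine ((h k).union ((const lc).inter (hQ.inter (h (k - 1))))).congr fun f t _ => ?_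
    exact (le_encard_inter_window_iff (Q f) k lc rc (lt_add_one t)).symm
  let EL : Signal AP → Set ℝ := fun f => {s | ¬ (s ∈ D True False f ↔ s ∈ D lc rc f)}
  let ER : Signal AP → Set ℝ := fun f => {s | ¬ (s ∈ D lc rc f ↔ s ∈ D False True f)}
  have hEL : Expressible EL := ((hD True False).iff (hD lc rc)).compl
  have hER : Expressible ER := ((hD lc rc).iff (hD False True)).compl
  have hbound : ∀ (E : Signal AP → Set ℝ), (∀ f, E f ⊆ criticalSites (Q f) k) → ∀ rc f t,
      (E f ∩ window False rc t (t + a)).encard ≤ (2 * k * a : ℕ) := by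
    intro E hE rc f t
    refine (encard_le_encard (inter_subset_inter (hE f) fun u hu => ?_)).trans
      (encard_criticalSites_inter_Ioc_natCast_le (Q f) k a t)
    exact ⟨by simpa using hu.1, (window_subset_Icc _ _ _ _ hu).2⟩
  have hELb := hbound EL (fun f s hs => mem_criticalSites hs)
  have hERb := hbound ER (fun f s hs => mem_criticalSites hs)
  have e1 : ∀ t : ℝ, window False True t (t + a) = Ioc t (t + a) := by
    intro t
    ext u
    simp [window, le_iff_lt_or_eq]
  have e2 : ∀ t : ℝ, window False False t (t + a) = Ioo t (t + a) := by
    intro t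
    ext u
    simp [window]
  refine (((hD False True).iff (hEL.odd_ncard_window True ha (hELb True))).iff
    (hER.odd_ncard_window False ha (hERb False))).congr fun f t _ => ?_
  simp only [mem_ofPred_eq, e1, e2]
  refine (mem_iff_odd_jumps (D := D lc rc f) (fun s => ?_) (fun s => ?_) ?_ ?_ ?_).symm
  · filter_upwards [(hsparse f).eventually_left lc rc s] with x hx
    simp only [D, mem_ofPred_eq, hx]
  · filter_upwards [(hsparse f).eventually_right lc rc s] with x hx
    simp only [D, mem_ofPred_eq, hx]
  · exact lt_add_of_pos_right t (by exact_mod_cast ha)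
  · rw [← e1]
    exact finite_of_encard_le_coe (hELb True f t)
  · rw [← e2]
    exact finite_of_encard_le_coe (hERb False f t)

/-! ### Arbitrary non-singular intervals -/

/-- The times immediately after which `S` holds for a while. -/
def rightInterior (S : Set ℝ) : Set ℝ := {s | ∃ u, s < u ∧ Ioo s u ⊆ S}

theorem Expressible.rightInterior {S : Signal AP → Set ℝ} (hS : Expressible S) :
    Expressible fun f => rightInterior (S f) := by
  have hI : (⟨0, ⊤, True, False⟩ : Interval) ∈ Interval.nonSingular :=
    show ((0 : ℕ) : ℕ∞) < ⊤ from ENat.natCast_lt_top 0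
  refine (hS.untl hI Expressible.univ).congr fun f t _ => exists_congr fun u => ?_
  have h : u ∈ Interval.after ⟨0, ⊤, True, False⟩ t ↔ t < u := by simp [after_top]
  simp only [Interval.after, mem_ofPred_eq] at h
  simp only [mem_univ, true_and]
  tauto

theorem Regulated.locallySparse_sdiff_rightInterior {S : Set ℝ} (hS : Regulated S) :
    LocallySparse (S \ TimedLogic.rightInterior S) := by
  intro s
  have aux : ∀ (l : Filter ℝ) (c d : ℝ), Ioo c d ∈ l → Ioo c d ⊆ S →
      ∀ᶠ x in l, x ∉ S \ TimedLogic.rightInterior S := by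
    intro l c d hl hcd
    filter_upwards [hl] with x hx
    exact fun h => h.2 ⟨d, hx.2, (Ioo_subset_Ioo_left hx.1.le).trans hcd⟩
  rw [← nhdsLT_sup_nhdsGT, eventually_sup]
  constructor
  · rcases hS s _ (.inl rfl) with h | h
    · obtain ⟨c, hc, h⟩ := mem_nhdsLT_iff_exists_Ioo_subset.1 h
      exact aux _ c s (Ioo_mem_nhdsLT hc) h
    · exact h.mono fun x hx hx' => hx hx'.1
  · rcases hS s _ (.inr rfl) with h | h
    · obtain ⟨c, hc, h⟩ := mem_nhdsGT_iff_exists_Ioo_subset.1 h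
      exact aux _ s c (Ioo_mem_nhdsGT hc) h
    · exact h.mono fun x hx hx' => hx hx'.1

/-- Reduction of counting to the discrete part `S \ rightInterior S`. If the right interior of
`S` meets the open window, there are infinitely many points to count. Otherwise all points of
`S` in the window belong to the discrete part, except possibly the right end of the window; and
then the right end is the only possible point of `S ∩ rightInterior S` in the window, so that
it need not be addressed by its exact distance. -/
theorem le_encard_window_iff_sdiff_rightInterior (S : Set ℝ) (k : ℕ) (lc rc : Prop) {x y : ℝ}
    (hxy : x < y) :
    (k : ℕ∞) ≤ (S ∩ window lc rc x y).encard ↔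
      (∃ u ∈ window False False x y, u ∈ rightInterior S) ∨
      (k : ℕ∞) ≤ ((S \ rightInterior S) ∩ window lc rc x y).encard ∨
      (rc ∧ (∃ u ∈ window False True x y, u ∈ S ∩ rightInterior S) ∧
        ((k - 1 : ℕ) : ℕ∞) ≤ ((S \ rightInterior S) ∩ window lc False x y).encard) := by
  have hoo : window False False x y = Ioo x y := by
    ext u
    simp [window]
  rw [hoo]
  by_cases h1 : ∃ u ∈ Ioo x y, u ∈ rightInterior S
  · refine iff_of_true ?_ (.inl h1)
    obtain ⟨u, hu, v, huv, hS⟩ := h1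
    refine natCast_le_encard_of_Ioo_subset (x := u) (y := min v y) (lt_min huv hu.2)
      (fun w hw => ?_) k
    obtain ⟨hwv, hwy⟩ := lt_min_iff.1 hw.2
    exact ⟨hS ⟨hw.1, hwv⟩, Ioo_subset_window _ _ _ _ ⟨hu.1.trans hw.1, hwy⟩⟩
  simp only [h1, false_or]
  have hx : x ∉ rightInterior S := by
    rintro ⟨v, hxv, hS⟩
    obtain ⟨w, hw1, hw2⟩ := exists_between (lt_min hxv hxy)
    obtain ⟨hwv, hwy⟩ := lt_min_iff.1 hw2
    exact h1 ⟨w, ⟨hw1, hwy⟩, v, hwv, (Ioo_subset_Ioo_left hw1.le).trans hS⟩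
  have hmem : ∀ u ∈ window lc rc x y, u ∈ rightInterior S → rc ∧ u = y := by
    rintro u ⟨hu1, hu2⟩ hu
    refine hu2.resolve_left fun hlt => ?_
    rcases hu1 with h | ⟨-, rfl⟩
    exacts [h1 ⟨u, ⟨h, hlt⟩, hu⟩, hx hu]
  constructor
  · intro hk
    by_cases hy : rc ∧ y ∈ S ∩ rightInterior S
    · refine .inr ⟨hy.1, ⟨y, ⟨.inl hxy, .inr ⟨trivial, rfl⟩⟩, hy.2⟩, ?_⟩
      rw [← natCast_le_add_one_iff]
      refine hk.trans ((encard_le_encard ?_).trans (encard_insert_le _ y))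
      rintro u ⟨huS, hu⟩
      by_cases huy : u = y
      · exact .inl huy
      · exact .inr ⟨⟨huS, fun h => huy (hmem u hu h).2⟩, hu.1,
          hu.2.imp id fun h => (huy h.2).elim⟩
    · refine .inl (hk.trans (encard_le_encard fun u hu => ⟨⟨hu.1, fun h => hy ?_⟩, hu.2⟩))
      obtain ⟨hrc, rfl⟩ := hmem u hu.2 h
      exact ⟨hrc, hu.1, h⟩
  · rintro (hk | ⟨hrc, ⟨u, hu, huS⟩, hk⟩)
    · exact hk.trans (encard_le_encard (inter_subset_inter_left _ sdiff_subset))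
    · have huy : u = y := by
        rcases hu.2 with h | h
        · exact (h1 ⟨u, ⟨hu.1.resolve_right fun h => h.1, h⟩, huS.2⟩).elim
        · exact h.2
      subst huy
      rw [← natCast_le_add_one_iff] at hk
      refine hk.trans ?_
      rw [← encard_insert_of_notMem (a := u) (by simp [window])]
      refine encard_le_encard (insert_subset ⟨huS.1, .inl hxy, .inr ⟨hrc, rfl⟩⟩ ?_)
      rintro w ⟨hw, hw1, hw2⟩
      exact ⟨hw.1, hw1, hw2.imp id fun h => h.1.elim⟩

theorem natCast_le_add_iff_exists (k : ℕ) (m n : ℕ∞) :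
    (k : ℕ∞) ≤ m + n ↔ ∃ i < k + 1, (i : ℕ∞) ≤ m ∧ ((k - i : ℕ) : ℕ∞) ≤ n := by
  constructor
  · intro h
    induction m using ENat.recTopCoe with
    | top => exact ⟨k, by omega, le_top, by simp⟩
    | coe m =>
      refine ⟨min m k, by omega, by exact_mod_cast min_le_left m k, ?_⟩
      induction n using ENat.recTopCoe with
      | top => exact le_top
      | coe n =>
        norm_cast at h ⊢
        omega
  · rintro ⟨i, hi, h1, h2⟩
    refine le_trans ?_ (add_le_add h1 h2)
    norm_cast
    omega

namespace Expressible

variable {S : Signal AP → Set ℝ}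

theorem le_encard_unit_window (hS : Expressible S) (hreg : ∀ f, Regulated (S f)) (k : ℕ)
    (lc rc : Prop) {a : ℕ} (ha : 0 < a) :
    Expressible fun f =>
      {t | (k : ℕ∞) ≤ (S f ∩ window lc rc (t + a) (t + a + 1)).encard} := by
  have hQ : Expressible fun f => S f \ TimedLogic.rightInterior (S f) :=
    hS.inter hS.rightInterior.compl
  have hsparse := fun f => (hreg f).locallySparse_sdiff_rightInterior
  have h1 := hS.rightInterior.exists_mem_window False False ha (Nat.lt_succ_self a)
  have h2 := (hS.inter hS.rightInterior).exists_mem_window False True ha (Nat.lt_succ_self a)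
  simp only [Nat.succ_eq_add_one, Nat.cast_add, Nat.cast_one, ← add_assoc] at h1 h2
  refine (h1.union ((hQ.le_encard_shifted_unit_window hsparse k lc rc ha).union ((const rc).inter
    (h2.inter (hQ.le_encard_shifted_unit_window hsparse (k - 1) lc False ha))))).congr
    fun f t _ => ?_
  exact (le_encard_window_iff_sdiff_rightInterior (S f) k lc rc (lt_add_one (t + a))).symm

/-- A bounded window at positive distance is split into unit windows. -/
theorem le_encard_bounded_window (hS : Expressible S) (hreg : ∀ f, Regulated (S f)) (k : ℕ)
    (lc rc : Prop) {a : ℕ} (ha : 0 < a) (n : ℕ) :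
    Expressible fun f =>
      {t | (k : ℕ∞) ≤ (S f ∩ window lc rc (t + a) (t + a + (n + 1))).encard} := by
  induction n generalizing k lc a with
  | zero => simpa using hS.le_encard_unit_window hreg k lc rc ha
  | succ n ih =>
    refine (exists_lt (k + 1) fun i => (hS.le_encard_unit_window hreg i lc True ha).inter
      (ih (k - i) False (Nat.succ_pos a))).congr fun f t _ => ?_
    have hsplit : S f ∩ window lc rc (t + a) (t + a + ((n + 1 : ℕ) + 1)) =
        (S f ∩ window lc True (t + a) (t + a + 1)) ∪
        (S f ∩ window False rc (t + (a + 1 : ℕ)) (t + (a + 1 : ℕ) + (n + 1))) := by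
      have hn : (0 : ℝ) ≤ n := n.cast_nonneg
      ext u
      simp only [mem_inter_iff, mem_union, window, mem_ofPred_eq, false_and, or_false, true_and,
        ← and_or_left]
      refine and_congr_right fun _ => ?_
      push_cast
      constructor
      · rintro ⟨h1, h2⟩
        rcases lt_trichotomy u (t + a + 1) with h | h | h
        · exact .inl ⟨h1, .inl h⟩
        · exact .inl ⟨h1, .inr h⟩
        · refine .inr ⟨by linarith, ?_⟩
          rcases h2 with h2 | ⟨hrc, h2⟩
          · exact .inl (by linarith)
          · exact .inr ⟨hrc, by linarith⟩
      · rintro (⟨h1, h2⟩ | ⟨h1, h2⟩)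
        · refine ⟨h1, .inl ?_⟩
          rcases h2 with h2 | h2 <;> linarith
        · refine ⟨.inl (by linarith), ?_⟩
          rcases h2 with h2 | ⟨hrc, h2⟩
          · exact .inl (by linarith)
          · exact .inr ⟨hrc, by linarith⟩
    have hdisj : Disjoint (S f ∩ window lc True (t + a) (t + a + 1))
        (S f ∩ window False rc (t + (a + 1 : ℕ)) (t + (a + 1 : ℕ) + (n + 1))) := by
      rw [disjoint_left]
      rintro u ⟨-, hu⟩ ⟨-, hu', -⟩
      have h1 := (window_subset_Icc _ _ _ _ hu).2
      have h2 := hu'.resolve_right fun h => h.1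
      push_cast at h2
      linarith
    simp only [mem_ofPred_eq, mem_inter_iff]
    rw [hsplit, encard_union_eq hdisj, natCast_le_add_iff_exists]

/-- Over an unbounded interval, it suffices to find a first point in the interval: all points
after it are in the interval too. -/
theorem countSet_of_upper_eq_top (hS : Expressible S) (k : ℕ) (a : ℕ) (lc rc : Prop) :
    Expressible fun f => countSet (k + 1) ⟨a, ⊤, lc, rc⟩ (S f) := by
  have h0 : (⟨0, ⊤, True, False⟩ : Interval) ∈ Interval.zeroBased :=
    ⟨show ((0 : ℕ) : ℕ∞) < ⊤ from ENat.natCast_lt_top 0, rfl, trivial⟩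
  have hI : (⟨a, ⊤, lc, rc⟩ : Interval) ∈ Interval.nonSingular :=
    show (a : ℕ∞) < ⊤ from ENat.natCast_lt_top a
  refine (univ.untl hI (hS.inter (hS.count h0 k))).congr fun f t _ => ?_
  have haft : ∀ u : ℝ, Interval.after ⟨0, ⊤, True, False⟩ u = Ioi u := by
    intro u
    ext v
    simp [after_top]
  simp only [untilSet, countSet, mem_ofPred_eq, haft, subset_univ, and_true, mem_inter_iff]
  constructor
  · rintro ⟨u, htu, hu, huS, hk⟩
    have huI : u ∈ Interval.after ⟨a, ⊤, lc, rc⟩ t := ⟨htu, hu⟩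
    rw [Nat.cast_add, Nat.cast_one]
    refine (add_le_add_left hk 1).trans ?_
    rw [← encard_insert_of_notMem (a := u) (by simp)]
    refine encard_le_encard (insert_subset ⟨huS, huI⟩ ?_)
    refine inter_subset_inter_right _ fun v hv => ?_
    rw [after_top] at huI ⊢
    left
    rcases huI with h | h
    · exact h.trans hv
    · exact h.2 ▸ hv
  · intro hk
    obtain ⟨F, hF, hcard⟩ := exists_subset_encard_eq hk
    have hne : F.Nonempty := by
      rw [← encard_pos, hcard]
      exact_mod_cast Nat.succ_pos k
    obtain ⟨m, hm, hmin⟩ := (finite_of_encard_eq_coe hcard).exists_minimalFor id F hne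
    refine ⟨m, (hF hm).2.1, (hF hm).2.2, (hF hm).1, ?_⟩
    have h1 := (natCast_le_add_one_iff (k + 1) (F \ {m}).encard).1
    rw [encard_sdiff_singleton_add_one hm] at h1
    refine (h1 hcard.ge).trans (encard_le_encard ?_)
    rintro x ⟨hx, hxm⟩
    exact ⟨(hF hx).1, lt_of_le_of_ne (le_of_not_gt fun h => not_lt.2 (hmin hx h.le) h)
      (Ne.symm hxm)⟩

/-- Counting over an arbitrary non-singular interval is expressible. -/
theorem count_nonSingular (hS : Expressible S) (hreg : ∀ f, Regulated (S f)) (k : ℕ)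
    {I : Interval} (hI : I ∈ Interval.nonSingular) :
    Expressible fun f => countSet k I (S f) := by
  obtain ⟨a, b, lc, rc⟩ := I
  induction b using ENat.recTopCoe with
  | top =>
    cases k with
    | zero => exact univ.congr fun f t _ => by simp [countSet]
    | succ k => exact hS.countSet_of_upper_eq_top k a lc rc
  | coe b =>
    have hab : a < b := by
      have : (a : ℕ∞) < b := hI
      exact_mod_cast this
    rcases Nat.eq_zero_or_pos a with rfl | ha
    · refine (hS.le_encard_window k rc hab).congr fun f t _ => ?_
      simp only [countSet, after_eq_window, lt_irrefl, false_and, Nat.cast_zero, add_zero]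
    · obtain ⟨n, rfl⟩ := Nat.exists_eq_add_of_lt hab
      refine (hS.le_encard_bounded_window hreg k lc rc ha n).congr fun f t _ => ?_
      simp only [countSet, after_eq_window, ha, true_and]
      push_cast
      simp only [add_assoc]

end Expressible

theorem expressible_truthSet {φ : Formula AP} (hφ : φ ∈ TLCIfut AP) :
    Expressible fun f => truthSet f φ := by
  have hself : ∀ {φ : Formula AP} {S : Signal AP → Set ℝ}, Expressible S →
      (∀ f, Represents f φ (S f)) → Expressible fun f => truthSet f φ := by
    intro φ S hS hr
    refine hS.congr fun f t ht => ?_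
    rw [(hr f).truthSet_eq]
    exact (and_iff_left ht).symm
  induction φ with
  | top => exact hself .univ fun f t => Iff.rfl
  | atom p => exact ⟨.atom p, trivial, fun f => represents_truthSet f _⟩
  | and φ ψ ihφ ihψ =>
    exact hself ((ihφ hφ.1).inter (ihψ hφ.2)) fun f t =>
      and_congr (represents_truthSet f φ t) (represents_truthSet f ψ t)
  | neg φ ih =>
    exact hself (ih hφ).compl fun f t => not_congr (represents_truthSet f φ t)
  | untl I φ ψ ihφ ihψ =>
    exact hself ((ihφ hφ.2.1).untl hφ.1 (ihψ hφ.2.2)) fun f =>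
      (represents_truthSet f φ).untl (represents_truthSet f ψ) I
  | count k I φ ih =>
    have hreg := fun f => regulated_truthSet f subset_rfl subset_rfl hφ.2
    exact hself ((ih hφ.2).count_nonSingular hreg k hφ.1) fun f =>
      (represents_truthSet f φ).count k I

end TimedLogic

theorem mainTheorem3 (AP : Type*) [Finite AP] :
    TimedLogic.AtMostAsExpressive (TimedLogic.TLCIfut AP) (TimedLogic.TLCfut AP) ∧
      TimedLogic.ExpressivelyComplete (TimedLogic.TLCfut AP) (TimedLogic.TLCIfut AP) := by
  have h : TimedLogic.ExpressivelyComplete (TimedLogic.TLCfut AP) (TimedLogic.TLCIfut AP) := by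
    intro φ hφ
    obtain ⟨ψ, hψ, hr⟩ := TimedLogic.expressible_truthSet hφ
    exact ⟨ψ, hψ, fun f t => (TimedLogic.represents_truthSet f φ t).trans (hr f t).symm⟩
  refine ⟨fun φ hφ => ?_, h⟩
  obtain ⟨ψ, hψ, heq⟩ := h φ hφ
  exact ⟨ψ, hψ, fun f => heq f 0⟩
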